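/- Let $F/\mathbf{F}_q$ be an algebraic function field of one variable over a finite field, let $Q, P_1,\dots,P_n$ be distinct places of degree one of $F$, and put $D=P_1+\cdots+P_n$. Let $v_Q$ be the normalized valuation at $Q$, and for a divisor $G$ put $\mathcal{L}(G+\infty Q)=\bigcup_{i}\mathcal{L}(G+iQ)$. Let $S=H(Q)$ be the Weierstrass semigroup at $Q$ (the set of nongaps), generated by positive integers $a_1,\dots,a_t$ ($t\ge 1$), and let $x_1,\dots,x_t\in F$ have pole divisors $(x_i)_\infty=a_iQ$. For $0\le i<a_1$ let $b_i=\min\{m\in S\mid m\equiv i \pmod{a_1}\}$, and let $L_i=(\ell_{i1},\dots,\ell_{it})$ be the $\prec$-least vector $(m_1,\dots,m_t)\in\mathbf{N}_0^t$ with $a_1m_1+\cdots+a_tm_t=b_i$, where $\prec$ compares vectors first by the weight $a_1m_1+\cdots+a_tm_t$ and, for equal weights, regards as smaller the vector having the larger entry at the first index where the two differ (so $\ell_{i1}=0$). Put $y_i=x_1^{\ell_{i1}}\cdots x_t^{\ell_{it}}$. For $0\le j<a_1$ let $\eta_j$ be any nonzero element of $\mathcal{L}(-D+\infty Q)$ whose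 pole order $-v_Q(\eta_j)$ is minimal among the nonzero $\eta\in\mathcal{L}(-D+\infty Q)$ with $-v_Q(\eta)\equiv j\pmod{a_1}$. For integers $u$ let $C_u=\{(f(P_1),\dots,f(P_n))\mid f\in\mathcal{L}(uQ)\}$ and let $S_{\mathrm{indep}}=\{u\mid C_u\ne C_{u-1}\}$. For $s\in S$ define $$\nu(s)=\frac1{a_1}\sum_{0\le i<a_1}\max\{-v_Q(\eta_{i'})+v_Q(y_i)-s,\,0\},\quad i'=(i+s)\bmod a_1,\qquad \lambda(s)=|\{j\in S\mid j+s\in S_{\mathrm{indep}}\}|.$$ Then for every $s\in S$ the set $\{j\in S\mid j+s\in S_{\mathrm{indep}}\}$ is finite and $\nu(s)=\lambda(s)$. Consequently, for every finite nonempty $\Gamma\subset S$, $$\tfrac12\min_{s\in\Gamma}\nu(s)=\tfrac12\,d_{\mathrm{AG}}(C_\Gamma),\qquad d_{\mathrm{AG}}(C_\Gamma):=\min_{s\in\Gamma}\lambda(s),$$ where the left-hand side is the error-correction capability of the decoding algorithm of Lee, Bras-Amorós and O'Sullivan (extended to one-point codes $C_\Gamma$ on general curves) and $d_{\mathrm{AG}}(C_\Gamma)$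 is the Andersen–Geil lower bound for the minimum distance of $C_\Gamma$. -/

import Mathlib

namespace OnePointAG

section Places

variable (k F : Type*) [Field k] [Field F] [Algebra k F]

/-- A place of `F/k`, given by its normalized discrete valuation: a valuation of `F` with values
in `ℤ ∪ {∞}` that is trivial on the constants `k` and takes the value `1`. -/
structure Place where
  val : AddValuation F (WithTop ℤ)
  map_const : ∀ c : k, c ≠ 0 → val (algebraMap k F c) = 0
  normalized : ∃ t : F, val t = 1

/-- Divisors of `F/k`. -/
abbrev Divisor := Place k F →₀ ℤ

variable {k F}

namespace Place

lemma val_const_nonneg (P : Place k F) (c : k) : 0 ≤ P.val (algebraMap k F c) := by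
  by_cases hc : c = 0
  · simp [hc]
  · rw [P.map_const c hc]

/-- The valuation ring of the place `P`. -/
def integers (P : Place k F) : Subalgebra k F where
  carrier := {f | 0 ≤ P.val f}
  mul_mem' {f g} hf hg := by
    simp only [Set.mem_ofPred_eq] at hf hg ⊢
    rw [AddValuation.map_mul]
    exact add_nonneg hf hg
  add_mem' {f g} hf hg := P.val.map_le_add hf hg
  algebraMap_mem' c := P.val_const_nonneg c

/-- The maximal ideal of the valuation ring of the place `P`. -/
def maxIdeal (P : Place k F) : Ideal P.integers where
  carrier := {f | 0 < P.val (f : F)}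
  zero_mem' := by simp
  add_mem' {f g} hf hg := by
    simp only [Set.mem_ofPred_eq] at hf hg ⊢
    exact P.val.map_lt_add hf hg
  smul_mem' c f hf := by
    simp only [Set.mem_ofPred_eq, smul_eq_mul] at hf ⊢
    have hc : 0 ≤ P.val (c : F) := c.2
    have h : P.val ((c * f : P.integers) : F) = P.val (c : F) + P.val (f : F) := by
      simp
    rw [h]
    exact lt_of_lt_of_le hf (le_add_of_nonneg_left hc)

/-- The degree of a place: the degree of its residue field over `k`. -/
noncomputable def degree (P : Place k F) : ℕ := Module.finrank k (P.integers ⧸ P.maxIdeal)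

/-- The integer `v_P(f)`, meant for `f ≠ 0`. -/
noncomputable def ord (P : Place k F) (f : F) : ℤ := (P.val f).untopD 0

open Classical in
/-- The value `f(P)` of `f` at a place `P` of degree one, for `f` regular at `P`: the constant
`c` with `f ≡ c` modulo the maximal ideal of `P`. -/
noncomputable def eval (P : Place k F) (f : F) : k :=
  if h : ∃ c : k, 0 < P.val (f - algebraMap k F c) then h.choose else 0

end Place

/-- The Riemann-Roch space `𝓛(G)`; zero belongs to it because `v_P(0) = ∞`. -/
def rrSpace (G : Divisor k F) : Set F :=
  {f | ∀ P : Place k F, ((-G P : ℤ) : WithTop ℤ) ≤ P.val f}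

/-- `𝓛(G + ∞Q) = ⋃ᵢ 𝓛(G + iQ)`. -/
def rrSpaceInfty (G : Divisor k F) (Q : Place k F) : Set F :=
  ⋃ i : ℕ, rrSpace (G + Finsupp.single Q (i : ℤ))

/-- The pole divisor `(f)_∞` of the nonzero function `f` is `G`. -/
def HasPoleDivisor (f : F) (G : Divisor k F) : Prop :=
  f ≠ 0 ∧ ∀ P : Place k F, G P = max (-P.ord f) 0

/-- The Weierstrass semigroup `H(Q)`: the set of nongaps at `Q`. -/
def weierstrass (Q : Place k F) : Set ℕ :=
  {m | ∃ f : F, HasPoleDivisor f (Finsupp.single Q (m : ℤ))}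

/-- The one-point code `C_u = {(f(P₁), …, f(Pₙ)) | f ∈ 𝓛(uQ)}`. -/
def code {n : ℕ} (Q : Place k F) (P : Fin n → Place k F) (u : ℤ) : Set (Fin n → k) :=
  {w | ∃ f ∈ rrSpace (Finsupp.single Q u), w = fun i => (P i).eval f}

/-- `S_indep = {u | C_u ≠ C_{u-1}}`. Negative `u` are left out, `C_u` being zero for them. -/
def indep {n : ℕ} (Q : Place k F) (P : Fin n → Place k F) : Set ℕ :=
  {u | code Q P (u : ℤ) ≠ code Q P ((u : ℤ) - 1)}

/-- The set `{j ∈ H(Q) | j + s ∈ S_indep}`. -/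
def lambdaSet {n : ℕ} (Q : Place k F) (P : Fin n → Place k F) (s : ℕ) : Set ℕ :=
  {j | j ∈ weierstrass Q ∧ j + s ∈ indep Q P}

/-- `λ(s)`, the number of `j ∈ H(Q)` with `j + s ∈ S_indep`. -/
noncomputable def lam {n : ℕ} (Q : Place k F) (P : Fin n → Place k F) (s : ℕ) : ℕ :=
  (lambdaSet Q P s).ncard

/-- `η` is an element of `𝓛(-D + ∞Q)`, `D = P₁ + ⋯ + Pₙ`, whose pole order at `Q` is minimal
among the nonzero elements of `𝓛(-D + ∞Q)` with pole order at `Q` congruent to `j` mod `a₁`. -/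
def IsEta {n : ℕ} (Q : Place k F) (P : Fin n → Place k F) (a₁ j : ℕ) (η : F) : Prop :=
  let I : Set F := rrSpaceInfty (-∑ i, Finsupp.single (P i) (1 : ℤ)) Q
  η ∈ I ∧ η ≠ 0 ∧ -Q.ord η ≡ (j : ℤ) [ZMOD (a₁ : ℤ)] ∧
    ∀ f ∈ I, f ≠ 0 → -Q.ord f ≡ (j : ℤ) [ZMOD (a₁ : ℤ)] → -Q.ord η ≤ -Q.ord f

end Places

section Exponents

variable {t : ℕ}

/-- The weight `a₁ m₁ + ⋯ + a_t m_t`. -/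
def weight (a m : Fin t → ℕ) : ℕ := ∑ i, a i * m i

/-- The monomial order: `m ≺ n` if `m` has smaller weight, or the weights agree and at the first
index where `m` and `n` differ the entry of `m` is the larger one. -/
def MonLT (a m n : Fin t → ℕ) : Prop :=
  weight a m < weight a n ∨
    (weight a m = weight a n ∧ ∃ i, (∀ j, j < i → m j = n j) ∧ n i < m i)

open Classical in
/-- The `≺`-least exponent vector of weight `b` (it exists whenever all `aᵢ` are positive and `b`
is the weight of some vector, see `minExponent_spec`). -/
noncomputable def minExponent (a : Fin t → ℕ) (b : ℕ) : Fin t → ℕ :=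
  if h : ∃ m, weight a m = b ∧ ∀ m', weight a m' = b → m' ≠ m → MonLT a m m' then h.choose else 0

lemma minExponent_spec (a : Fin t → ℕ) (ha : ∀ i, 0 < a i) (b : ℕ) (hb : ∃ m, weight a m = b) :
    weight a (minExponent a b) = b ∧
      ∀ m', weight a m' = b → m' ≠ minExponent a b → MonLT a (minExponent a b) m' := by
  have h : ∃ m, weight a m = b ∧ ∀ m', weight a m' = b → m' ≠ m → MonLT a m m' := by
    have hfin : {m : Lex (Fin t → ℕ) | weight a (ofLex m) = b}.Finite := by
      apply Set.Finite.subset (s := toLex '' Set.Iic (fun _ : Fin t => b))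
        ((Set.finite_Iic _).image _)
      intro m hm
      refine ⟨ofLex m, ?_, rfl⟩
      intro i
      have h1 : a i * (ofLex m) i ≤ weight a (ofLex m) :=
        Finset.single_le_sum (f := fun i => a i * (ofLex m) i) (fun _ _ => Nat.zero_le _)
          (Finset.mem_univ i)
      have h2 : (ofLex m) i ≤ a i * (ofLex m) i := Nat.le_mul_of_pos_left _ (ha i)
      exact h2.trans (h1.trans (le_of_eq hm))
    obtain ⟨m0, hm0⟩ := hb
    obtain ⟨M, hM, hmax⟩ := hfin.exists_maximal ⟨toLex m0, hm0⟩
    refine ⟨ofLex M, hM, fun m' hm' hne => Or.inr ⟨by rw [hm', hM], ?_⟩⟩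
    have hlt : toLex m' < M := by
      rcases lt_trichotomy (toLex m') M with h | h | h
      · exact h
      · exact absurd (by rw [← h]; rfl) hne
      · exact absurd (hmax hm' h.le) (not_le_of_gt h)
    obtain ⟨i, hi, hi'⟩ := hlt
    exact ⟨i, fun j hj => (hi j hj).symm, hi'⟩
  have e : minExponent a b = h.choose := by
    unfold minExponent
    rw [dif_pos h]
  rw [e]
  exact h.choose_spec

end Exponents

section Nu

variable {k F : Type*} [Field k] [Field F] [Algebra k F] {t : ℕ} [NeZero t]

/-- `b_i = min {m ∈ H(Q) | m ≡ i mod a₁}`. -/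
noncomputable def minNongap (Q : Place k F) (a₁ i : ℕ) : ℕ :=
  sInf {m | m ∈ weierstrass Q ∧ m ≡ i [MOD a₁]}

/-- `y_i = x₁^{ℓ₁} ⋯ x_t^{ℓ_t}`, where `L_i = (ℓ₁, …, ℓ_t)` is the `≺`-least vector of weight
`b_i`; its first entry `ℓ₁` is `0` by the minimality of `b_i`. -/
noncomputable def yMon (Q : Place k F) (a : Fin t → ℕ) (x : Fin t → F) (i : ℕ) : F :=
  ∏ j, x j ^ minExponent a (minNongap Q (a 0) i) j

/-- `ν(s) = (1/a₁) ∑_{0 ≤ i < a₁} max {-v_Q(η_{i'}) + v_Q(y_i) - s, 0}`, `i' = i + s mod a₁`. -/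
noncomputable def nu (Q : Place k F) (a : Fin t → ℕ) (x : Fin t → F) (η : ℕ → F) (s : ℕ) : ℚ :=
  (1 / (a 0 : ℚ)) * ∑ i ∈ Finset.range (a 0),
    ((max (-Q.ord (η ((i + s) % a 0)) + Q.ord (yMon Q a x i) - (s : ℤ)) 0 : ℤ) : ℚ)

/-- The error-correction capability of the decoding algorithm for `C_Γ`:
half of `min {ν(s) | s ∈ Γ}`. -/
noncomputable def decodingRadius (Q : Place k F) (a : Fin t → ℕ) (x : Fin t → F) (η : ℕ → F)
    (Γ : Finset ℕ) (hΓ : Γ.Nonempty) : ℚ :=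
  Γ.inf' hΓ (nu Q a x η) / 2

/-- The Andersen-Geil bound `d_AG(C_Γ) = min {λ(s) | s ∈ Γ}`. -/
noncomputable def dAG {n : ℕ} (Q : Place k F) (P : Fin n → Place k F)
    (Γ : Finset ℕ) (hΓ : Γ.Nonempty) : ℕ :=
  Γ.inf' hΓ (lam Q P)

end Nu

end OnePointAG

/-! Let `S` be the set of nongaps and `T` the set of pole orders at `Q` of nonzero elements of `𝓛(-D
+ ∞Q)`. Such elements have zero codeword, and two functions with the same codeword differ by an
element of `𝓛(-D + ∞Q)`; hence `S_indep = S \ T` (`mem_indep_iff`). As `S` is closed under addition,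
for `j, s ∈ S` the condition `j + s ∈ S_indep` just says `j + s ∉ T`.

Multiplication by `x₁` makes both `S` and `T` stable under adding `a₁`, so each is a half-line in
every residue class mod `a₁`, starting at `b_i` and at `-v_Q(η_i)` respectively. The `j` counted by
`λ(s)` in class `i` therefore form the progression of step `a₁` from `b_i` up to, but excluding,
`-v_Q(η_{i'}) - s`. Its length times `a₁` is the `i`-th term of `ν(s)`, because `-v_Q(y_i) = b_i`
(`ord_yMon`); `finite_and_card_of_classes` does this count. -/

namespace OnePointAG

/-! ### Valuations, residues at places of degree one, and pole divisors -/

section Valuation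

variable {k F : Type*} [Field k] [Field F] [Algebra k F]

namespace Place

lemma val_eq_ord (P : Place k F) {f : F} (hf : f ≠ 0) : P.val f = (P.ord f : WithTop ℤ) := by
  have h : P.val f ≠ ⊤ := fun h => hf ((AddValuation.top_iff _).1 h)
  obtain ⟨m, hm⟩ := WithTop.ne_top_iff_exists.1 h
  simp [ord, ← hm]

lemma ord_mul (P : Place k F) {f g : F} (hf : f ≠ 0) (hg : g ≠ 0) :
    P.ord (f * g) = P.ord f + P.ord g := by
  have h := P.val.map_mul f g
  rw [P.val_eq_ord hf, P.val_eq_ord hg, P.val_eq_ord (mul_ne_zero hf hg)] at h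
  exact_mod_cast h

lemma ord_one (P : Place k F) : P.ord (1 : F) = 0 := by
  simp [ord]

lemma ord_pow (P : Place k F) {f : F} (hf : f ≠ 0) (m : ℕ) : P.ord (f ^ m) = m * P.ord f := by
  induction m with
  | zero => simp [ord_one]
  | succ m ih =>
    rw [pow_succ, P.ord_mul (pow_ne_zero _ hf) hf, ih]
    push_cast
    ring

lemma ord_prod (P : Place k F) {ι : Type*} (s : Finset ι) (f : ι → F) (hf : ∀ i ∈ s, f i ≠ 0) :
    P.ord (∏ i ∈ s, f i) = ∑ i ∈ s, P.ord (f i) := by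
  classical
  induction s using Finset.induction_on with
  | empty => simp [ord_one]
  | insert i s hi ih =>
    rw [Finset.prod_insert hi, Finset.sum_insert hi, P.ord_mul (hf i (Finset.mem_insert_self i s))
      (Finset.prod_ne_zero_iff.2 fun j hj => hf j (Finset.mem_insert_of_mem hj)),
      ih fun j hj => hf j (Finset.mem_insert_of_mem hj)]

lemma val_sub_pos (P : Place k F) {f g : F} (hf : 0 < P.val f) (hg : 0 < P.val g) :
    0 < P.val (f - g) := by
  rw [sub_eq_add_neg]
  exact P.val.map_lt_add hf (by rwa [AddValuation.map_neg])

lemma exists_const (P : Place k F) (hP : P.degree = 1) {f : F} (hf : 0 ≤ P.val f) :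
    ∃ c : k, 0 < P.val (f - algebraMap k F c) := by
  have h1 : (1 : P.integers ⧸ P.maxIdeal) ≠ 0 := by
    intro h
    have h' : (1 : P.integers) ∈ P.maxIdeal := by
      rw [← Ideal.Quotient.eq_zero_iff_mem, map_one]
      exact h
    have h'' : 0 < P.val ((1 : P.integers) : F) := h'
    rw [show ((1 : P.integers) : F) = 1 from rfl, AddValuation.map_one] at h''
    exact lt_irrefl _ h''
  obtain ⟨c, hc⟩ := (finrank_eq_one_iff_of_nonzero' _ h1).1 hP
    (Ideal.Quotient.mk P.maxIdeal ⟨f, hf⟩)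
  refine ⟨c, ?_⟩
  have h2 : (⟨f, hf⟩ - algebraMap k P.integers c : P.integers) ∈ P.maxIdeal := by
    rw [← Ideal.Quotient.eq_zero_iff_mem, map_sub, ← hc, sub_eq_zero,
      Algebra.algebraMap_eq_smul_one]
    rfl
  exact h2

lemma eval_spec (P : Place k F) (hP : P.degree = 1) {f : F} (hf : 0 ≤ P.val f) :
    0 < P.val (f - algebraMap k F (P.eval f)) := by
  have h := P.exists_const hP hf
  unfold eval
  rw [dif_pos h]
  exact h.choose_spec

lemma eval_eq_iff (P : Place k F) (hP : P.degree = 1) {f g : F} (hf : 0 ≤ P.val f)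
    (hg : 0 ≤ P.val g) : P.eval f = P.eval g ↔ 0 < P.val (f - g) := by
  have h1 := P.eval_spec hP hf
  have h2 := P.eval_spec hP hg
  constructor
  · intro h
    rw [h] at h1
    simpa using P.val_sub_pos h1 h2
  · intro h
    by_contra hne
    have h3 : 0 < P.val ((f - g) - ((f - algebraMap k F (P.eval f)) -
        (g - algebraMap k F (P.eval g)))) := P.val_sub_pos h (P.val_sub_pos h1 h2)
    have h4 : (f - g) - ((f - algebraMap k F (P.eval f)) - (g - algebraMap k F (P.eval g))) =
        algebraMap k F (P.eval f - P.eval g) := by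
      rw [map_sub]
      ring
    rw [h4, P.map_const _ (sub_ne_zero.2 hne)] at h3
    exact lt_irrefl _ h3

/-- The quotient `f / h` is a unit at `P`, and degree one makes its residue a constant `c`;
subtracting `c * h` cancels the leading term of `f`. -/
lemma exists_val_lt_sub (P : Place k F) (hP : P.degree = 1) {f h : F} (hf : f ≠ 0) (hh : h ≠ 0)
    (hfh : P.ord f = P.ord h) :
    ∃ c : k, (P.ord f : WithTop ℤ) < P.val (f - algebraMap k F c * h) := by
  have h0 : P.val (f / h) = 0 := by
    have h1 : P.ord f = P.ord (f / h) + P.ord h := by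
      rw [← P.ord_mul (div_ne_zero hf hh) hh, div_mul_cancel₀ _ hh]
    rw [P.val_eq_ord (div_ne_zero hf hh), show P.ord (f / h) = 0 by omega]
    rfl
  obtain ⟨c, hc⟩ := P.exists_const hP h0.ge
  refine ⟨c, ?_⟩
  have h2 : f - algebraMap k F c * h = (f / h - algebraMap k F c) * h := by
    field_simp
  rcases eq_or_ne (f / h - algebraMap k F c) 0 with h3 | h3
  · rw [h2, h3, zero_mul, AddValuation.map_zero]
    exact WithTop.coe_lt_top _
  · rw [P.val_eq_ord h3] at hc
    rw [h2, P.val_eq_ord (mul_ne_zero h3 hh), P.ord_mul h3 hh]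
    norm_cast at hc ⊢
    omega

lemma val_const_mul (P : Place k F) (c : k) {h : F} {m : WithTop ℤ} (hm : m ≤ P.val h) :
    m ≤ P.val (algebraMap k F c * h) := by
  rw [AddValuation.map_mul]
  exact hm.trans (le_add_of_nonneg_left (P.val_const_nonneg c))

end Place

lemma mem_rrSpace_single {Q : Place k F} {u : ℤ} {f : F} :
    f ∈ rrSpace (Finsupp.single Q u) ↔
      ((-u : ℤ) : WithTop ℤ) ≤ Q.val f ∧ ∀ P, P ≠ Q → 0 ≤ P.val f := by
  constructor
  · intro h
    refine ⟨by simpa using h Q, fun P hP => ?_⟩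
    have := h P
    rwa [Finsupp.single_eq_of_ne hP] at this
  · rintro ⟨h1, h2⟩ P
    by_cases hP : P = Q
    · subst hP
      simpa using h1
    · rw [Finsupp.single_eq_of_ne hP]
      exact h2 P hP

lemma mem_weierstrass_of_ord {Q : Place k F} {f : F} {u : ℕ} (hf : f ≠ 0)
    (hP : ∀ P, P ≠ Q → 0 ≤ P.val f) (hu : -Q.ord f = u) : u ∈ weierstrass Q := by
  refine ⟨f, hf, fun P => ?_⟩
  by_cases h : P = Q
  · subst h
    simp [hu]
  · have h1 := hP P h
    rw [P.val_eq_ord hf] at h1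
    norm_cast at h1
    rw [Finsupp.single_eq_of_ne h]
    omega

lemma HasPoleDivisor.val_nonneg {Q : Place k F} {f : F} {u : ℤ}
    (h : HasPoleDivisor f (Finsupp.single Q u)) (P : Place k F) (hP : P ≠ Q) : 0 ≤ P.val f := by
  have h1 := h.2 P
  rw [Finsupp.single_eq_of_ne hP] at h1
  rw [P.val_eq_ord h.1]
  norm_cast
  omega

lemma HasPoleDivisor.ord_eq {Q : Place k F} {f : F} {u : ℤ} (hu : 0 < u)
    (h : HasPoleDivisor f (Finsupp.single Q u)) : -Q.ord f = u := by
  have h1 := h.2 Q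
  rw [Finsupp.single_eq_same] at h1
  omega

lemma exists_of_mem_weierstrass {Q : Place k F} {u : ℕ} (hu : u ∈ weierstrass Q) :
    ∃ f : F, f ≠ 0 ∧ (∀ P, P ≠ Q → 0 ≤ P.val f) ∧ -Q.ord f = u := by
  -- A zero pole divisor does not by itself exclude a zero at `Q`, so for `u = 0` the function `1`
  -- replaces the given one.
  rcases Nat.eq_zero_or_pos u with rfl | hpos
  · exact ⟨1, one_ne_zero, fun P _ => by simp, by simp [Place.ord_one]⟩
  · obtain ⟨f, hf⟩ := hu
    exact ⟨f, hf.1, hf.val_nonneg, hf.ord_eq (by exact_mod_cast hpos)⟩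

end Valuation

/-! ### Independent pole orders of the evaluation codes -/

section Code

variable {k F : Type*} [Field k] [Field F] [Algebra k F] {n : ℕ}

lemma mem_rrSpaceInfty {Q : Place k F} {P : Fin n → Place k F} (hPinj : Function.Injective P)
    (hPQ : ∀ i, P i ≠ Q) {f : F} :
    f ∈ rrSpaceInfty (-∑ i, Finsupp.single (P i) (1 : ℤ)) Q ↔
      (∀ i, 0 < (P i).val f) ∧ ∀ R, R ≠ Q → 0 ≤ R.val f := by
  classical
  rcases eq_or_ne f 0 with rfl | hf
  · simp [rrSpaceInfty, rrSpace]
  have key : ∀ (m : ℕ) (R : Place k F),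
      -(-∑ i, Finsupp.single (P i) (1 : ℤ) + Finsupp.single Q (m : ℤ)) R =
        (∑ i, if P i = R then (1 : ℤ) else 0) - if Q = R then (m : ℤ) else 0 := by
    intro m R
    simp only [Finsupp.add_apply, Finsupp.neg_apply, Finsupp.finsetSum_apply,
      Finsupp.single_apply]
    ring
  simp only [rrSpaceInfty, rrSpace, Set.mem_iUnion, Set.mem_ofPred_eq, key, Place.val_eq_ord _ hf,
    WithTop.coe_pos, WithTop.coe_nonneg, WithTop.coe_le_coe]
  constructor
  · rintro ⟨m, hm⟩
    constructor
    · intro i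
      have h := hm (P i)
      rw [if_neg (hPQ i).symm] at h
      simp only [hPinj.eq_iff, Finset.sum_ite_eq', Finset.mem_univ, if_true] at h
      omega
    · intro R hR
      have h := hm R
      rw [if_neg (Ne.symm hR)] at h
      have h0 : 0 ≤ ∑ i, if P i = R then (1 : ℤ) else 0 :=
        Finset.sum_nonneg fun i _ => by split_ifs <;> simp
      omega
  · rintro ⟨h1, h2⟩
    -- The pole order at `Q`, truncated to `0` if `f` is regular there.
    refine ⟨(-Q.ord f).toNat, fun R => ?_⟩
    by_cases hR : R = Q
    · subst hR
      simp only [hPQ, if_false, Finset.sum_const_zero, if_true]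
      omega
    · rw [if_neg (Ne.symm hR)]
      by_cases hi : ∃ i, P i = R
      · obtain ⟨i, rfl⟩ := hi
        have := h1 i
        simp only [hPinj.eq_iff, Finset.sum_ite_eq', Finset.mem_univ, if_true]
        omega
      · push Not at hi
        have := h2 R hR
        simp only [hi, if_false, Finset.sum_const_zero]
        omega

/-- `u ∈ S_indep` exactly when `u` is a nongap that is not a pole order of an element of
`𝓛(-D + ∞Q)`. -/
lemma mem_indep_iff {Q : Place k F} {P : Fin n → Place k F} (hQ : Q.degree = 1)
    (hP : ∀ i, (P i).degree = 1) (hPinj : Function.Injective P) (hPQ : ∀ i, P i ≠ Q) {u : ℕ} :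
    u ∈ indep Q P ↔ u ∈ weierstrass Q ∧
      ¬ ∃ h ∈ rrSpaceInfty (-∑ i, Finsupp.single (P i) (1 : ℤ)) Q, h ≠ 0 ∧ -Q.ord h = u := by
  have heval : ∀ {f g : F}, (∀ R, R ≠ Q → 0 ≤ R.val f) → (∀ R, R ≠ Q → 0 ≤ R.val g) →
      (((fun i => (P i).eval f) = fun i => (P i).eval g) ↔ ∀ i, 0 < (P i).val (f - g)) := by
    intro f g hf hg
    rw [funext_iff]
    exact forall_congr' fun i => (P i).eval_eq_iff (hP i) (hf _ (hPQ i)) (hg _ (hPQ i))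
  have hsub : code Q P ((u : ℤ) - 1) ⊆ code Q P (u : ℤ) := by
    rintro w ⟨f, hf, rfl⟩
    rw [mem_rrSpace_single] at hf
    refine ⟨f, mem_rrSpace_single.2 ⟨le_trans ?_ hf.1, hf.2⟩, rfl⟩
    rw [WithTop.coe_le_coe]
    omega
  have hdrop : ∀ {f : F}, (((-(u : ℤ) : ℤ) : WithTop ℤ) < Q.val f) →
      (∀ R, R ≠ Q → 0 ≤ R.val f) → f ∈ rrSpace (Finsupp.single Q ((u : ℤ) - 1)) := by
    intro f h1 h2
    refine mem_rrSpace_single.2 ⟨?_, h2⟩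
    rcases eq_or_ne f 0 with rfl | hf
    · simp
    · rw [Q.val_eq_ord hf] at h1 ⊢
      rw [WithTop.coe_lt_coe] at h1
      rw [WithTop.coe_le_coe]
      omega
  have hord : ∀ {f : F}, f ∈ rrSpace (Finsupp.single Q (u : ℤ)) →
      ¬ (((-(u : ℤ) : ℤ) : WithTop ℤ) < Q.val f) → f ≠ 0 ∧ -Q.ord f = u := by
    intro f hf hlt
    have hf' := (mem_rrSpace_single.1 hf).1
    have hf0 : f ≠ 0 := by
      rintro rfl
      rw [AddValuation.map_zero] at hlt
      exact hlt (WithTop.coe_lt_top _)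
    refine ⟨hf0, ?_⟩
    rw [Q.val_eq_ord hf0] at hf' hlt
    norm_cast at hf' hlt
    omega
  constructor
  · intro hu
    by_contra hcon
    apply hu
    refine (Set.Subset.antisymm hsub ?_).symm
    rintro w ⟨f, hf, rfl⟩
    have hf' := mem_rrSpace_single.1 hf
    by_cases hlt : ((-(u : ℤ) : ℤ) : WithTop ℤ) < Q.val f
    · exact ⟨f, hdrop hlt hf'.2, rfl⟩
    · obtain ⟨hf0, hfu⟩ := hord hf hlt
      have hS := mem_weierstrass_of_ord hf0 hf'.2 hfu
      rw [not_and, not_not] at hcon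
      obtain ⟨h, hI, hh0, hhu⟩ := hcon hS
      rw [mem_rrSpaceInfty hPinj hPQ] at hI
      -- Subtracting `c * h` lowers the pole order at `Q` and keeps the codeword, since `h` vanishes
      -- at every `P i`.
      obtain ⟨c, hc⟩ := Q.exists_val_lt_sub hQ hf0 hh0 (by omega)
      have hreg : ∀ R, R ≠ Q → 0 ≤ R.val (f - algebraMap k F c * h) := fun R hR =>
        R.val.map_le_sub (hf'.2 R hR) (R.val_const_mul c (hI.2 R hR))
      refine ⟨f - algebraMap k F c * h, hdrop ?_ hreg, (heval hf'.2 hreg).2 fun i => ?_⟩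
      · rwa [show -(u : ℤ) = Q.ord f by omega]
      · rw [sub_sub_cancel, AddValuation.map_mul]
        exact lt_of_lt_of_le (hI.1 i) (le_add_of_nonneg_left ((P i).val_const_nonneg c))
  -- If `f` of pole order `u` shares its codeword with some `g` of smaller pole order, then `f - g`
  -- vanishes at every `P i` and still has pole order `u`.
  · rintro ⟨hS, hT⟩ heq
    obtain ⟨f, hf0, hfreg, hfu⟩ := exists_of_mem_weierstrass hS
    have hfc : (fun i => (P i).eval f) ∈ code Q P (u : ℤ) := by
      refine ⟨f, mem_rrSpace_single.2 ⟨?_, hfreg⟩, rfl⟩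
      rw [Q.val_eq_ord hf0]
      norm_cast
      omega
    rw [heq] at hfc
    obtain ⟨g, hg, hfg⟩ := hfc
    rw [mem_rrSpace_single] at hg
    have hlt : Q.val f < Q.val g := by
      refine lt_of_lt_of_le ?_ hg.1
      rw [Q.val_eq_ord hf0, WithTop.coe_lt_coe]
      omega
    have hval : Q.val (f - g) = Q.val f := by
      rw [AddValuation.map_sub_swap]
      exact AddValuation.map_sub_eq_of_lt_right _ hlt
    have hne : f - g ≠ 0 := by
      intro h
      rw [sub_eq_zero] at h
      rw [h] at hlt
      exact lt_irrefl _ hlt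
    refine hT ⟨f - g, (mem_rrSpaceInfty hPinj hPQ).2 ⟨(heval hfreg hg.2).1 hfg,
      fun R hR => R.val.map_le_sub (hfreg R hR) (hg.2 R hR)⟩, hne, ?_⟩
    rw [← hfu]
    simp [Place.ord, hval]

end Code

/-! ### Counting by residue classes, and semigroup generators -/

section Counting

/-- Counting, residue class by residue class modulo `a`, the `j` that lie above `b` in their class
while `j + s` lies below `c` in its class. -/
lemma finite_and_card_of_classes {a : ℕ} (ha : 0 < a) (b : ℕ → ℕ) (c : ℕ → ℤ) (s : ℕ)
    (hb : ∀ i < a, b i ≡ i [MOD a]) (hc : ∀ i < a, c i ≡ (i : ℤ) [ZMOD (a : ℤ)]) :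
    {j : ℕ | b (j % a) ≤ j ∧ ((j + s : ℕ) : ℤ) < c ((j + s) % a)}.Finite ∧
      (a : ℤ) * ({j : ℕ | b (j % a) ≤ j ∧ ((j + s : ℕ) : ℤ) < c ((j + s) % a)}.ncard : ℤ) =
        ∑ i ∈ Finset.range a, max (c ((i + s) % a) - (b i : ℤ) - (s : ℤ)) 0 := by
  classical
  have ha' : (0 : ℤ) < a := by exact_mod_cast ha
  have hdvd : ∀ i < a, (a : ℤ) ∣ c ((i + s) % a) - (b i : ℤ) - (s : ℤ) := by
    intro i hi
    have h1 : c ((i + s) % a) ≡ ((i + s : ℕ) : ℤ) [ZMOD (a : ℤ)] :=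
      (hc _ (Nat.mod_lt _ ha)).trans (Int.natCast_modEq_iff.2 (Nat.mod_modEq _ _))
    have h2 : ((b i + s : ℕ) : ℤ) ≡ ((i + s : ℕ) : ℤ) [ZMOD (a : ℤ)] :=
      Int.natCast_modEq_iff.2 ((hb i hi).add_right s)
    have h3 := (h2.trans h1.symm).dvd
    rwa [show c ((i + s) % a) - (b i : ℤ) - (s : ℤ) = c ((i + s) % a) - ((b i + s : ℕ) : ℤ) by
      push_cast; ring]
  -- `d i` is the signed number of steps of length `a` from `b i + s` to the bound `c`; its
  -- truncation `(d i).toNat` is the count in class `i`.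
  choose! d hd using hdvd
  have hmod : ∀ i < a, ∀ m, (b i + a * m) % a = i := by
    intro i hi m
    rw [Nat.add_mul_mod_self_left, hb i hi, Nat.mod_eq_of_lt hi]
  have hset : {j : ℕ | b (j % a) ≤ j ∧ ((j + s : ℕ) : ℤ) < c ((j + s) % a)} =
      (((Finset.range a).sigma fun i => Finset.range (d i).toNat).image
        fun p : (_ : ℕ) × ℕ => b p.1 + a * p.2 : Finset ℕ) := by
    have hiff : ∀ i < a, ∀ m : ℕ,
        ((b i + a * m + s : ℕ) : ℤ) < c ((b i + a * m + s) % a) ↔ m < (d i).toNat := by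
      intro i hi m
      have h1 : (b i + a * m + s) % a = (i + s) % a := by
        rw [Nat.add_mod, hmod i hi m, Nat.add_mod i s, Nat.mod_eq_of_lt hi]
      rw [h1]
      have h2 := hd i hi
      rw [show ((b i + a * m + s : ℕ) : ℤ) < c ((i + s) % a) ↔ (a : ℤ) * m < a * d i by
        rw [← h2]; push_cast; constructor <;> intro h <;> linarith, mul_lt_mul_iff_right₀ ha']
      omega
    ext j
    simp only [Set.mem_ofPred_eq, Finset.coe_image, Set.mem_image, Finset.mem_coe,
      Finset.mem_sigma, Finset.mem_range]
    constructor
    · rintro ⟨h1, h2⟩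
      have hj := Nat.mod_lt j ha
      obtain ⟨m, hm⟩ := (Nat.modEq_iff_dvd' h1).1 ((hb _ hj).trans (Nat.mod_modEq j a))
      have hjm : b (j % a) + a * m = j := by omega
      refine ⟨⟨j % a, m⟩, ⟨hj, (hiff _ hj m).1 ?_⟩, hjm⟩
      rwa [hjm]
    · rintro ⟨⟨i, m⟩, ⟨hi, hm⟩, rfl⟩
      refine ⟨?_, (hiff i hi m).2 hm⟩
      rw [hmod i hi m]
      exact Nat.le_add_right _ _
  rw [hset]
  refine ⟨Finset.finite_toSet _, ?_⟩
  rw [Set.ncard_coe_finset, Finset.card_image_of_injOn, Finset.card_sigma]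
  · push_cast
    rw [Finset.mul_sum]
    refine Finset.sum_congr rfl fun i hi => ?_
    rw [hd i (Finset.mem_range.1 hi), Finset.card_range, Int.toNat_eq_max,
      mul_max_of_nonneg _ _ ha'.le, mul_zero]
  · rintro ⟨i, m⟩ h1 ⟨i', m'⟩ h2 h
    simp only [Finset.coe_sigma, Set.mem_sigma_iff, Finset.mem_coe, Finset.mem_range] at h1 h2 h
    have hi : i = i' := by
      rw [← hmod i h1.1 m, h, hmod i' h2.1 m']
    subst hi
    have := Nat.eq_of_mul_eq_mul_left ha (Nat.add_left_cancel h)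
    rw [this]

/-- Ensures that `minExponent` does not fall back to its default value `0`. -/
lemma exists_weight_of_mem_closure {t : ℕ} (a : Fin t → ℕ) {b : ℕ}
    (hb : b ∈ AddSubmonoid.closure (Set.range a)) : ∃ m, weight a m = b := by
  induction hb using AddSubmonoid.closure_induction with
  | mem x hx =>
    obtain ⟨i, rfl⟩ := hx
    exact ⟨Pi.single i 1, by simp [weight, Pi.single_apply]⟩
  | zero => exact ⟨0, by simp [weight]⟩
  | add x y _ _ hx hy =>
    obtain ⟨m, rfl⟩ := hx
    obtain ⟨m', rfl⟩ := hy
    exact ⟨m + m', by simp [weight, mul_add, Finset.sum_add_distrib]⟩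

end Counting

/-! ### Comparison of `ν` and `λ` -/

section Main

variable {k F : Type*} [Field k] [Field F] [Algebra k F] {n t : ℕ} [NeZero t]

/-- `-v_Q(y_i) = b_i`. -/
lemma ord_yMon {Q : Place k F} {a : Fin t → ℕ} (ha : ∀ i, 0 < a i)
    (hgen : (AddSubmonoid.closure (Set.range a) : Set ℕ) = weierstrass Q) {x : Fin t → F}
    (hx : ∀ i, HasPoleDivisor (x i) (Finsupp.single Q (a i : ℤ))) {i : ℕ}
    (hi : minNongap Q (a 0) i ∈ weierstrass Q) :
    Q.ord (yMon Q a x i) = -(minNongap Q (a 0) i : ℤ) := by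
  have hb : minNongap Q (a 0) i ∈ AddSubmonoid.closure (Set.range a) := by
    rw [← SetLike.mem_coe, hgen]
    exact hi
  have hw := (minExponent_spec a ha _ (exists_weight_of_mem_closure a hb)).1
  rw [yMon, Place.ord_prod _ _ _ fun j _ => pow_ne_zero _ (hx j).1]
  conv_rhs => rw [← hw, weight]
  push_cast
  rw [← Finset.sum_neg_distrib]
  refine Finset.sum_congr rfl fun j _ => ?_
  have h := (hx j).ord_eq (by exact_mod_cast ha j)
  rw [Place.ord_pow _ (hx j).1, show Q.ord (x j) = -(a j : ℤ) by omega]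
  ring

lemma lambdaSet_finite_and_nu_eq_lam {Q : Place k F} {P : Fin n → Place k F} (hQ : Q.degree = 1)
    (hP : ∀ i, (P i).degree = 1) (hPinj : Function.Injective P) (hPQ : ∀ i, P i ≠ Q)
    {a : Fin t → ℕ} (ha : ∀ i, 0 < a i)
    (hgen : (AddSubmonoid.closure (Set.range a) : Set ℕ) = weierstrass Q)
    {x : Fin t → F} (hx : ∀ i, HasPoleDivisor (x i) (Finsupp.single Q (a i : ℤ)))
    {η : ℕ → F} (hη : ∀ j < a 0, IsEta Q P (a 0) j (η j)) {s : ℕ} (hs : s ∈ weierstrass Q) :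
    (lambdaSet Q P s).Finite ∧ nu Q a x η s = (lam Q P s : ℚ) := by
  have hadd : ∀ {u v : ℕ}, u ∈ weierstrass Q → v ∈ weierstrass Q → u + v ∈ weierstrass Q := by
    intro u v
    rw [← hgen]
    exact add_mem
  have hmul : ∀ m : ℕ, a 0 * m ∈ weierstrass Q := by
    intro m
    rw [← hgen, mul_comm]
    exact nsmul_mem (AddSubmonoid.subset_closure (Set.mem_range_self 0)) m
  have hx0 := (hx 0).ord_eq (by exact_mod_cast ha 0)
  have ha0 : (0 : ℤ) < a 0 := by exact_mod_cast ha 0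
  -- the pole orders of `𝓛(-D + ∞Q)` in one class are closed under adding `a₁`
  have hshift : ∀ j < a 0, ∀ m : ℕ,
      η j * x 0 ^ m ∈ rrSpaceInfty (-∑ i, Finsupp.single (P i) (1 : ℤ)) Q ∧
        η j * x 0 ^ m ≠ 0 ∧ -Q.ord (η j * x 0 ^ m) = -Q.ord (η j) + a 0 * m := by
    intro j hj m
    obtain ⟨hI, h0, -, -⟩ := hη j hj
    rw [mem_rrSpaceInfty hPinj hPQ] at hI
    have hxm : ∀ R, R ≠ Q → 0 ≤ R.val (x 0 ^ m) := fun R hR => by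
      rw [AddValuation.map_pow]
      exact nsmul_nonneg ((hx 0).val_nonneg R hR) m
    refine ⟨(mem_rrSpaceInfty hPinj hPQ).2 ⟨fun i => ?_, fun R hR => ?_⟩,
      mul_ne_zero h0 (pow_ne_zero _ (hx 0).1), ?_⟩
    · rw [AddValuation.map_mul]
      exact lt_of_lt_of_le (hI.1 i) (le_add_of_nonneg_right (hxm _ (hPQ i)))
    · rw [AddValuation.map_mul]
      exact add_nonneg (hI.2 R hR) (hxm R hR)
    · rw [Place.ord_mul _ h0 (pow_ne_zero _ (hx 0).1), Place.ord_pow _ (hx 0).1, ← hx0]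
      ring
  have hbmem : ∀ i < a 0, minNongap Q (a 0) i ∈ weierstrass Q ∧
      minNongap Q (a 0) i ≡ i [MOD a 0] := by
    intro i hi
    apply Nat.sInf_mem (s := {m | m ∈ weierstrass Q ∧ m ≡ i [MOD a 0]})
    -- The class must contain a nongap for `sInf` to be attained. The power of `x 0` compensates for
    -- a zero that `η i` might a priori have at `Q`.
    obtain ⟨hI, h0, hordη⟩ := hshift i hi (Q.ord (η i)).toNat
    have hnn : 0 ≤ -Q.ord (η i) + a 0 * ((Q.ord (η i)).toNat : ℤ) := by
      have h1 := Int.self_le_toNat (Q.ord (η i))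
      nlinarith [Int.natCast_nonneg (Q.ord (η i)).toNat]
    obtain ⟨u, hu⟩ := Int.eq_ofNat_of_zero_le hnn
    refine ⟨u, mem_weierstrass_of_ord h0 ((mem_rrSpaceInfty hPinj hPQ).1 hI).2
      (hordη.trans hu), ?_⟩
    rw [← Int.natCast_modEq_iff, ← hu]
    exact (Int.modEq_add_fac_self).trans (hη i hi).2.2.1
  have hS : ∀ j : ℕ, j ∈ weierstrass Q ↔ minNongap Q (a 0) (j % a 0) ≤ j := by
    intro j
    have hj := hbmem _ (Nat.mod_lt j (ha 0))
    constructor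
    · intro h
      exact Nat.sInf_le ⟨h, (Nat.mod_modEq _ _).symm⟩
    · intro h
      obtain ⟨m, hm⟩ := (Nat.modEq_iff_dvd' h).1 (hj.2.trans (Nat.mod_modEq _ _))
      rw [show j = minNongap Q (a 0) (j % a 0) + a 0 * m by omega]
      exact hadd hj.1 (hmul m)
  have hT : ∀ u : ℕ, (∃ h ∈ rrSpaceInfty (-∑ i, Finsupp.single (P i) (1 : ℤ)) Q,
      h ≠ 0 ∧ -Q.ord h = u) ↔ -Q.ord (η (u % a 0)) ≤ u := by
    intro u
    have hu := Nat.mod_lt u (ha 0)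
    have hmod : ((u % a 0 : ℕ) : ℤ) ≡ (u : ℤ) [ZMOD (a 0 : ℤ)] :=
      Int.natCast_modEq_iff.2 (Nat.mod_modEq _ _)
    constructor
    · rintro ⟨h, hI, h0, hh⟩
      rw [← hh]
      refine (hη _ hu).2.2.2 h hI h0 ?_
      rw [hh]
      exact hmod.symm
    · intro hle
      obtain ⟨d, hd⟩ := ((hη _ hu).2.2.1.trans hmod).dvd
      have hd0 : 0 ≤ d := by
        by_contra hneg
        have : (a 0 : ℤ) * d < 0 := mul_neg_of_pos_of_neg ha0 (by omega)
        omega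
      obtain ⟨m, rfl⟩ := Int.eq_ofNat_of_zero_le hd0
      obtain ⟨hI, h0, hordη⟩ := hshift _ hu m
      exact ⟨_, hI, h0, by rw [hordη]; omega⟩
  have hset : lambdaSet Q P s = {j : ℕ | minNongap Q (a 0) (j % a 0) ≤ j ∧
      ((j + s : ℕ) : ℤ) < -Q.ord (η ((j + s) % a 0))} := by
    ext j
    simp only [lambdaSet, Set.mem_ofPred_eq]
    rw [mem_indep_iff hQ hP hPinj hPQ, hT, not_le, ← hS]
    -- Here `s ∈ S` is used: it makes `j + s` a nongap for free.
    exact ⟨fun h => ⟨h.1, h.2.2⟩, fun h => ⟨h.1, hadd h.1 hs, h.2⟩⟩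
  obtain ⟨hfin, hcard⟩ := finite_and_card_of_classes (ha 0) (minNongap Q (a 0))
    (fun j => -Q.ord (η j)) s (fun i hi => (hbmem i hi).2) (fun i hi => (hη i hi).2.2.1)
  rw [← hset] at hfin hcard
  refine ⟨hfin, ?_⟩
  have hsum : ∑ i ∈ Finset.range (a 0),
      max (-Q.ord (η ((i + s) % a 0)) + Q.ord (yMon Q a x i) - (s : ℤ)) 0 =
        (a 0 : ℤ) * (lam Q P s : ℤ) := by
    rw [lam, hcard]
    refine Finset.sum_congr rfl fun i hi => ?_
    rw [ord_yMon ha hgen hx (hbmem i (Finset.mem_range.1 hi)).1, sub_eq_add_neg (-Q.ord _)]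
  have ha0' : (a 0 : ℚ) ≠ 0 := by exact_mod_cast (ha 0).ne'
  rw [nu, ← Int.cast_sum, hsum]
  push_cast
  field_simp

end Main

end OnePointAG

theorem mainTheorem3 {k F : Type*} [Field k] [Finite k] [Field F] [Algebra k F]
    [Algebra (RatFunc k) F] [IsScalarTower k (RatFunc k) F] [FunctionField k F]
    {n : ℕ} (Q : OnePointAG.Place k F) (P : Fin n → OnePointAG.Place k F)
    (hQ : Q.degree = 1) (hP : ∀ i, (P i).degree = 1)
    (hPinj : Function.Injective P) (hPQ : ∀ i, P i ≠ Q)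
    {t : ℕ} [NeZero t] (a : Fin t → ℕ) (ha : ∀ i, 0 < a i)
    (hgen : (AddSubmonoid.closure (Set.range a) : Set ℕ) = OnePointAG.weierstrass Q)
    (x : Fin t → F) (hx : ∀ i, OnePointAG.HasPoleDivisor (x i) (Finsupp.single Q (a i : ℤ)))
    (η : ℕ → F) (hη : ∀ j < a 0, OnePointAG.IsEta Q P (a 0) j (η j)) :
    (∀ s ∈ OnePointAG.weierstrass Q,
      (OnePointAG.lambdaSet Q P s).Finite ∧
        OnePointAG.nu Q a x η s = (OnePointAG.lam Q P s : ℚ)) ∧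
    ∀ (Γ : Finset ℕ) (hΓ : Γ.Nonempty), (Γ : Set ℕ) ⊆ OnePointAG.weierstrass Q →
      OnePointAG.decodingRadius Q a x η Γ hΓ = (OnePointAG.dAG Q P Γ hΓ : ℚ) / 2 := by
  have key : ∀ s ∈ OnePointAG.weierstrass Q, (OnePointAG.lambdaSet Q P s).Finite ∧
      OnePointAG.nu Q a x η s = (OnePointAG.lam Q P s : ℚ) := fun s hs =>
    OnePointAG.lambdaSet_finite_and_nu_eq_lam hQ hP hPinj hPQ ha hgen hx hη hs
  refine ⟨key, fun Γ hΓ hsub => ?_⟩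
  rw [OnePointAG.decodingRadius, OnePointAG.dAG,
    Finset.apply_inf'_eq_inf'_comp hΓ (Nat.cast : ℕ → ℚ) fun x y => Nat.cast_min x y]
  congr 1
  exact Finset.inf'_congr hΓ rfl fun s hs => (key s (hsub hs)).2
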